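/- **Bipartite NullCodeword.** Let $\Sigma$ be a finite alphabet and $C\subseteq\Sigma^n$ a code. Alice receives the first half $H_A=(H_1,\dots,H_{\lfloor n/2\rfloor})$ and Bob the remaining part $H_B=(H_{\lfloor n/2\rfloor+1},\dots,H_n)$ of a sequence of maps $H_1,\dots,H_n:\Sigma\to\{0,1\}$. The search problem $\mathrm{BiNC}^C_n$ is the relation of all $(H_A,H_B,x)$ with $x\in C$ and $H_i(x_i)=0$ for every $i\in[n]$. The $p$-biased input distribution sets each bit $H_i(a)$ ($i\in[n]$, $a\in\Sigma$) to $1$ with probability $p$, independently. **List-recoverability.** $C\subseteq\Sigma^n$ is $(\zeta,\ell,L)$-list-recoverable if for all $S_1,\dots,S_n\subseteq\Sigma$ with $|S_i|\le\ell$ for every $i\in[n]$, $$\bigl|\{x\in C:\ |\{i\in[n]: x_i\in S_i\}|\ge \zeta n\}\bigr|\le L .$$ **Communication complexity.** In a public-coin randomized two-way protocol, Alice and Bob exchange bits, each of which depends on the sender's input, the previous messages and the public randomness; at the end Bob outputs an element of $\Sigma^n$ depending on the transcript, his input and the public randomness. The cost is the worst-case number of bits sent. The randomized communication complexity of a relation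 over an input distribution with error $\varepsilon$ is the least cost of such a protocol whose output violates the relation with probability at most $\varepsilon$, over the random input and the public randomness (and $\infty$ if there is no such protocol). **Theorem.** For all constants $p\in(0,1)$ and $\varepsilon\in[0,1)$ there is a constant $c>0$ such that the following holds. Let $C=\{C_n\}_{n\in\mathbb N}$ be a family of codes $C_n\subseteq\Sigma_n^n$ over finite alphabets $\Sigma_n$ such that each $C_n$ is $(\zeta_n,\ell_n,L_n)$-list-recoverable, where $\zeta_n\le 0.4$ and $L_n\le 2^{o(n)}$. Then, for all sufficiently large $n$, the randomized two-way communication complexity of $\mathrm{BiNC}^C_n$ over the $p$-biased input distribution with error $\varepsilon$ is at least $c\,\ell_n$. In particular it is $\Omega(\ell)$. -/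

import Mathlib

open Filter Asymptotics MeasureTheory ProbabilityTheory
open scoped ENNReal

/-- A deterministic two-way communication protocol (protocol tree) on inputs `x : X` (Alice) and
`y : Y` (Bob). At an internal node Alice (resp. Bob) sends one bit, computed from her (resp. his)
input and, implicitly through the position in the tree, from the previous messages. At a leaf, Bob
outputs an element of `O`, computed from the transcript and his input. -/
inductive DetProtocol (X Y O : Type*) where
  | output (out : Y → O) : DetProtocol X Y O
  | alice (msg : X → Bool) (next : Bool → DetProtocol X Y O) : DetProtocol X Y O
  | bob (msg : Y → Bool) (next : Bool → DetProtocol X Y O) : DetProtocol X Y O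

namespace DetProtocol

/-- The output of the protocol on the input `(x, y)`. -/
def eval {X Y O : Type*} : DetProtocol X Y O → X → Y → O
  | output out, _, y => out y
  | alice msg next, x, y => (next (msg x)).eval x y
  | bob msg next, x, y => (next (msg y)).eval x y

/-- The total number of bits sent by the two players on the input `(x, y)`. -/
def bitsSent {X Y O : Type*} : DetProtocol X Y O → X → Y → ℕ
  | output _, _, _ => 0
  | alice msg next, x, y => (next (msg x)).bitsSent x y + 1
  | bob msg next, x, y => (next (msg y)).bitsSent x y + 1

end DetProtocol

noncomputable section

/-- A public-coin randomized protocol: the public randomness selects the deterministic protocol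
that is run. -/
abbrev RandProtocol (X Y O : Type*) := PMF (DetProtocol X Y O)

/-- Worst-case (over inputs and over the public randomness) number of bits sent. -/
def RandProtocol.cost {X Y O : Type*} (P : RandProtocol X Y O) : ℕ∞ :=
  ⨆ t ∈ P.support, ⨆ x : X, ⨆ y : Y, (t.bitsSent x y : ℕ∞)

/-- The probability, over the public randomness and an independent input `(x, y) ∼ μ`, that the
output `o` of the protocol satisfies `(x, y, o) ∉ R`. -/
def RandProtocol.errorProb {X Y O : Type*} [MeasurableSpace X] [MeasurableSpace Y]
    (P : RandProtocol X Y O) (μ : Measure (X × Y)) (R : Set (X × Y × O)) : ℝ≥0∞ :=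
  ∑' t : DetProtocol X Y O, P t * μ {z | (z.1, z.2, t.eval z.1 z.2) ∉ R}

/-- The randomized two-way communication complexity of the two-party search problem `R` over the
input distribution `μ` with error `ε`: the least cost of a public-coin protocol whose error
probability is at most `ε` (and `⊤` if there is no such protocol). -/
def randCC {X Y O : Type*} [MeasurableSpace X] [MeasurableSpace Y]
    (R : Set (X × Y × O)) (μ : Measure (X × Y)) (ε : ℝ) : ℕ∞ :=
  ⨅ (P : RandProtocol X Y O) (_ : P.errorProb μ R ≤ ENNReal.ofReal ε), P.cost

/-- `(ζ, ℓ, L)`-list-recoverability of a code `C ⊆ A ^ n` over a finite alphabet `A`. -/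
def ListRecoverable {n : ℕ} {A : Type*} [Finite A] (C : Set (Fin n → A)) (ζ ℓ L : ℝ) : Prop :=
  ∀ S : Fin n → Set A, (∀ i, ((S i).ncard : ℝ) ≤ ℓ) →
    (({x ∈ C | ζ * (n : ℝ) ≤ (({i | x i ∈ S i} : Set (Fin n)).ncard : ℝ)}.ncard : ℕ) : ℝ) ≤ L

/-- Alice's input `H_A`: the first half of the oracles `H_1, …, H_n : A → {0, 1}`
(the first `⌊n/2⌋` of them if `n` is odd). -/
abbrev AliceInput (n : ℕ) (A : Type*) := {i : Fin n // (i : ℕ) < n / 2} → A → Bool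

/-- Bob's input `H_B`: the second half of the oracles `H_1, …, H_n : A → {0, 1}`. -/
abbrev BobInput (n : ℕ) (A : Type*) := {i : Fin n // n / 2 ≤ (i : ℕ)} → A → Bool

/-- The two halves `(H_A, H_B)` of `H = (H_1, …, H_n)`. -/
def splitOracle {n : ℕ} {A : Type*} (H : Fin n → A → Bool) : AliceInput n A × BobInput n A :=
  (fun i => H i, fun i => H i)

/-- Bipartite NullCodeword: given `(H_A, H_B)`, find a codeword `x ∈ C` all of whose symbols are
mapped to `0` by the corresponding oracles. -/
def BiNC {n : ℕ} {A : Type*} (C : Set (Fin n → A)) :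
    Set (AliceInput n A × BobInput n A × (Fin n → A)) :=
  {w | w.2.2 ∈ C ∧ (∀ i, w.1 i (w.2.2 i) = false) ∧ ∀ i, w.2.1 i (w.2.2 i) = false}

/-- The `p`-biased distribution of `H = (H_1, …, H_n)`: every bit `H_i(a)` is `1` with
probability `p`, independently. -/
def biasedOracle (n : ℕ) (A : Type*) [Fintype A] (p : unitInterval) :
    Measure (Fin n → A → Bool) :=
  Measure.pi fun _ => Measure.pi fun _ => bernoulliMeasure true false p

/-- The `p`-biased distribution on the inputs `(H_A, H_B)` of the two players. -/
def biasedInput (n : ℕ) (A : Type*) [Fintype A] (p : unitInterval) :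
    Measure (AliceInput n A × BobInput n A) :=
  (biasedOracle n A p).map splitOracle

end

/-! By Yao's principle (`natCast_le_randCC`) it suffices to bound the success of a deterministic
protocol. Follow the tree on rectangles `X' × Y'` and record sets `SA`, `SB` of input bits known to
be `0` there. Whenever some codeword with fewer than `θ = 0.4 n` recorded positions on one side is
consistent with more than a fraction `δ` of that side, split by consistency with it and record its
positions in the consistent part. So both sides stay "refined": only codewords with many recorded
positions are likely. While at most `ℓ` bits are recorded, list-recoverability leaves at most `L`
such "fixed" words.

A potential bounds the success mass. Write `u`, `v` for the masses of the sides and `S` for the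
recorded bits. Its `gain` part counts the fixed words by their success mass and reserves `δ u v` for
each of the words that may still become fixed, plus one reserve for the unfixed word answered at a
leaf. The other part is `u v (2 log (1 / (u v)) - α |S|) / (α ℓ)` with `α = -log (1 - p)`. Since `u
v ≤ exp (-α |S|)`, it is at least `u v |S| / ℓ`, which exceeds the whole mass once `|S| > ℓ`.

Splitting by a likely word never raises the potential (`potential_query_le`): the entropy created is
paid for by the newly recorded bits. A message raises it by at most `2 log 2 / (α ℓ)` times the mass
(`potential_message_le`). Starting from `δ (L + 1)`, `d` bits give success at most `δ (L + 1) + 2 d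
log 2 / (α ℓ)` (`success_le`). With `δ` exponentially small in `n`, constant success forces `d =
Ω(ℓ)`. -/

/-! ### Entropy created by splitting a mass in two. -/

/-- With `u = a + b`, the increase is `a log (u/a) + b log (u/b)`, where `log (u/a) ≤ -log δ` and `b
log (u/b) ≤ b (u/b - 1) = a`. The bound is proportional to `a` alone, as needed: in a query only the
part of mass `a` gains recorded bits. -/
theorem negMulLog_add_le_of_mul_le {a b δ : ℝ} (hδ : 0 < δ) (ha : 0 < a) (hb : 0 ≤ b)
    (h : δ * (a + b) ≤ a) :
    Real.negMulLog a + Real.negMulLog b ≤ Real.negMulLog (a + b) + a * (1 - Real.log δ) := by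
  have hu : 0 < a + b := by linarith
  have h1 : Real.log δ + Real.log (a + b) ≤ Real.log a := by
    rw [← Real.log_mul hδ.ne' hu.ne']
    exact Real.log_le_log (by positivity) h
  have h2 : Real.negMulLog b ≤ -b * Real.log (a + b) + a := by
    rcases hb.eq_or_lt with rfl | hb'
    · simp [ha.le]
    · have := Real.log_le_sub_one_of_pos (div_pos hu hb')
      rw [Real.log_div hu.ne' hb'.ne'] at this
      have h3 : b * (Real.log (a + b) - Real.log b) ≤ b * ((a + b) / b - 1) :=
        mul_le_mul_of_nonneg_left this hb
      have h4 : b * ((a + b) / b - 1) = a := by field_simp; ring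
      rw [Real.negMulLog]
      linarith
  have h3 := mul_le_mul_of_nonneg_left h1 ha.le
  simp only [Real.negMulLog] at *
  linarith

/-- Midpoint concavity of `Real.negMulLog`: one bit carries entropy at most `log 2`. -/
theorem negMulLog_add_le {a b : ℝ} (ha : 0 ≤ a) (hb : 0 ≤ b) :
    Real.negMulLog a + Real.negMulLog b ≤ Real.negMulLog (a + b) + (a + b) * Real.log 2 := by
  obtain ⟨-, hc⟩ := Real.concaveOn_negMulLog
  have h := hc (show a ∈ Set.Ici (0 : ℝ) from ha) (show b ∈ Set.Ici (0 : ℝ) from hb)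
    (show (0 : ℝ) ≤ 1 / 2 by norm_num) (show (0 : ℝ) ≤ 1 / 2 by norm_num) (by norm_num)
  simp only [smul_eq_mul] at h
  rw [← mul_add, ← mul_add, Real.negMulLog_mul] at h
  have : Real.negMulLog (1 / 2) = 1 / 2 * Real.log 2 := by
    rw [Real.negMulLog, one_div, Real.log_inv]; ring
  rw [this] at h
  linarith

/-! ### Abstract weighted search problems and penalized success. -/

/-- One player's side of a search problem over the word type `W`: weighted inputs `X`, input bits
indexed by `P`, and for each word the set of bits that have to be `0`. -/
structure OracleSide (W X P : Type*) where
  weight : X → ℝ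
  weight_nonneg : ∀ x, 0 ≤ weight x
  bit : P → X → Bool
  pos : W → Finset P

namespace OracleSide

variable {W X P Y Q : Type*}

/-- All bits of `x` at the positions of `w` vanish. -/
def Good (s : OracleSide W X P) (w : W) (x : X) : Prop := ∀ p ∈ s.pos w, s.bit p x = false

instance (s : OracleSide W X P) (w : W) : DecidablePred (s.Good w) := fun x =>
  inferInstanceAs (Decidable (∀ p ∈ s.pos w, s.bit p x = false))

/-- All bits at positions in `S` vanish on `X'`. -/
def ZeroOn (s : OracleSide W X P) (X' : Finset X) (S : Finset P) : Prop :=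
  ∀ x ∈ X', ∀ p ∈ S, s.bit p x = false

def mass (s : OracleSide W X P) (X' : Finset X) : ℝ := ∑ x ∈ X', s.weight x

/-- The mass of the inputs in `X'` that are consistent with the word `w`. -/
def hit (s : OracleSide W X P) (X' : Finset X) (w : W) : ℝ := s.mass (X'.filter (s.Good w))

theorem mass_nonneg (s : OracleSide W X P) (X' : Finset X) : 0 ≤ s.mass X' :=
  Finset.sum_nonneg fun x _ => s.weight_nonneg x

theorem hit_nonneg (s : OracleSide W X P) (X' : Finset X) (w : W) : 0 ≤ s.hit X' w :=
  s.mass_nonneg _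

theorem mass_mono (s : OracleSide W X P) {X₁ X₂ : Finset X} (h : X₁ ⊆ X₂) :
    s.mass X₁ ≤ s.mass X₂ :=
  Finset.sum_le_sum_of_subset_of_nonneg h fun x _ _ => s.weight_nonneg x

theorem hit_le_mass (s : OracleSide W X P) (X' : Finset X) (w : W) : s.hit X' w ≤ s.mass X' :=
  s.mass_mono (Finset.filter_subset _ _)

theorem mass_filter_add (s : OracleSide W X P) (X' : Finset X) (q : X → Prop) [DecidablePred q] :
    s.mass (X'.filter q) + s.mass (X'.filter fun x => ¬ q x) = s.mass X' :=
  Finset.sum_filter_add_sum_filter_not _ _ _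

theorem hit_filter_add (s : OracleSide W X P) (X' : Finset X) (w : W) (q : X → Prop)
    [DecidablePred q] :
    s.hit (X'.filter q) w + s.hit (X'.filter fun x => ¬ q x) w = s.hit X' w := by
  rw [hit, hit, hit, Finset.filter_comm, Finset.filter_comm (s.Good w)]
  convert s.mass_filter_add (X'.filter (s.Good w)) q using 3
  all_goals first | rfl | exact Finset.filter_comm ..

theorem ZeroOn.subset {s : OracleSide W X P} {X₁ X₂ : Finset X} {S : Finset P}
    (h : s.ZeroOn X₂ S) (h' : X₁ ⊆ X₂) : s.ZeroOn X₁ S := fun x hx => h x (h' hx)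

/-- The success indicator of an answer `w` on the input `(x, y)`. -/
def succeeds (sA : OracleSide W X P) (sB : OracleSide W Y Q) (C : Finset W) (x : X) (y : Y)
    (w : W) : Prop := w ∈ C ∧ sA.Good w x ∧ sB.Good w y

variable {sA : OracleSide W X P} {sB : OracleSide W Y Q} {C : Finset W}

open scoped Classical in
/-- The success mass of a protocol on a rectangle, with a penalty for each bit sent. -/
noncomputable def value (sA : OracleSide W X P) (sB : OracleSide W Y Q) (C : Finset W) (κ : ℝ)
    (t : DetProtocol X Y W) (X' : Finset X) (Y' : Finset Y) : ℝ :=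
  ∑ x ∈ X', ∑ y ∈ Y', sA.weight x * sB.weight y *
    ((if succeeds sA sB C x y (t.eval x y) then 1 else 0) - κ * t.bitsSent x y)

theorem value_alice (κ : ℝ) (msg : X → Bool) (next : Bool → DetProtocol X Y W) (X' : Finset X)
    (Y' : Finset Y) :
    value sA sB C κ (.alice msg next) X' Y' =
      value sA sB C κ (next true) (X'.filter fun x => msg x = true) Y' +
      value sA sB C κ (next false) (X'.filter fun x => ¬ msg x = true) Y' -
      κ * (sA.mass X' * sB.mass Y') := by
  have h : ∀ (X₁ : Finset X) (b : Bool), (∀ x ∈ X₁, msg x = b) →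
      value sA sB C κ (.alice msg next) X₁ Y' =
        value sA sB C κ (next b) X₁ Y' - κ * (sA.mass X₁ * sB.mass Y') := by
    intro X₁ b hb
    rw [value, value, mass, mass, Finset.sum_mul_sum, Finset.mul_sum, ← Finset.sum_sub_distrib]
    refine Finset.sum_congr rfl fun x hx => ?_
    rw [Finset.mul_sum, ← Finset.sum_sub_distrib]
    refine Finset.sum_congr rfl fun y _ => ?_
    have h1 : (DetProtocol.alice msg next).eval x y = (next b).eval x y := by
      rw [DetProtocol.eval, hb x hx]
    have h2 : (DetProtocol.alice msg next).bitsSent x y = (next b).bitsSent x y + 1 := by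
      rw [DetProtocol.bitsSent, hb x hx]
    rw [h1, h2]
    push_cast
    ring
  rw [value, ← Finset.sum_filter_add_sum_filter_not X' (fun x => msg x = true), ← value, ← value,
    h _ true (by simp), h _ false (by simp), ← sA.mass_filter_add X' (fun x => msg x = true)]
  ring

theorem value_bob (κ : ℝ) (msg : Y → Bool) (next : Bool → DetProtocol X Y W) (X' : Finset X)
    (Y' : Finset Y) :
    value sA sB C κ (.bob msg next) X' Y' =
      value sA sB C κ (next true) X' (Y'.filter fun y => msg y = true) +
      value sA sB C κ (next false) X' (Y'.filter fun y => ¬ msg y = true) -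
      κ * (sA.mass X' * sB.mass Y') := by
  have h : ∀ (Y₁ : Finset Y) (b : Bool), (∀ y ∈ Y₁, msg y = b) →
      value sA sB C κ (.bob msg next) X' Y₁ =
        value sA sB C κ (next b) X' Y₁ - κ * (sA.mass X' * sB.mass Y₁) := by
    intro Y₁ b hb
    rw [value, value, mass, mass, Finset.sum_mul_sum, Finset.mul_sum, ← Finset.sum_sub_distrib]
    refine Finset.sum_congr rfl fun x hx => ?_
    rw [Finset.mul_sum, ← Finset.sum_sub_distrib]
    refine Finset.sum_congr rfl fun y hy => ?_
    have h1 : (DetProtocol.bob msg next).eval x y = (next b).eval x y := by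
      rw [DetProtocol.eval, hb y hy]
    have h2 : (DetProtocol.bob msg next).bitsSent x y = (next b).bitsSent x y + 1 := by
      rw [DetProtocol.bitsSent, hb y hy]
    rw [h1, h2]
    push_cast
    ring
  have h' : value sA sB C κ (.bob msg next) X' Y' =
      value sA sB C κ (.bob msg next) X' (Y'.filter fun y => msg y = true) +
      value sA sB C κ (.bob msg next) X' (Y'.filter fun y => ¬ msg y = true) := by
    simp only [value]
    rw [← Finset.sum_add_distrib]
    exact Finset.sum_congr rfl fun x _ =>
      (Finset.sum_filter_add_sum_filter_not Y' (fun y => msg y = true) _).symm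
  rw [h', h _ true (by simp), h _ false (by simp), ← sB.mass_filter_add Y' (fun y => msg y = true)]
  ring

/-! ### Refined rectangles and the potential. -/

variable [DecidableEq P] [DecidableEq Q]

/-- No word with few positions in `S` is likely to be consistent with an input from `X'`. -/
def Refined (s : OracleSide W X P) (C : Finset W) (θ δ : ℝ) (X' : Finset X) (S : Finset P) :
    Prop :=
  ∀ w ∈ C, ((s.pos w ∩ S).card : ℝ) < θ → s.hit X' w ≤ δ * s.mass X'

/-- The hypotheses on one side: sets of inputs with `k` vanishing bits have mass at most
`exp (-α k)`, and words with fewer than `θ` positions in `S` have many positions outside `S`. -/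
structure IsHard (s : OracleSide W X P) (C : Finset W) (α θ δ : ℝ) : Prop where
  mass_le : ∀ X' S, s.ZeroOn X' S → s.mass X' ≤ Real.exp (-(α * S.card))
  gap : ∀ w ∈ C, ∀ S : Finset P, ((s.pos w ∩ S).card : ℝ) < θ →
    2 * (1 - Real.log δ) ≤ α * (s.pos w \ S).card

theorem IsHard.le_negMulLog {s : OracleSide W X P} {C : Finset W} {α θ δ : ℝ}
    (h : s.IsHard C α θ δ) {X' : Finset X} {S : Finset P} (hz : s.ZeroOn X' S) :
    α * S.card * s.mass X' ≤ Real.negMulLog (s.mass X') := by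
  rcases (s.mass_nonneg X').eq_or_lt with h0 | h0
  · simp [← h0]
  · have := Real.log_le_log h0 (h.mass_le X' S hz)
    rw [Real.log_exp] at this
    have := mul_le_mul_of_nonneg_left this h0.le
    rw [Real.negMulLog]
    linarith

/-- The words of `C` with at least `θ` positions in the fixed sets `SA`, `SB`. -/
noncomputable def fixedWords (sA : OracleSide W X P) (sB : OracleSide W Y Q) (C : Finset W) (θ : ℝ)
    (SA : Finset P) (SB : Finset Q) : Finset W :=
  C.filter fun w => θ ≤ ((sA.pos w ∩ SA).card : ℝ) + ((sB.pos w ∩ SB).card : ℝ)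

theorem fixedWords_comm (sA : OracleSide W X P) (sB : OracleSide W Y Q) (C : Finset W) (θ : ℝ)
    (SA : Finset P) (SB : Finset Q) :
    fixedWords sB sA C θ SB SA = fixedWords sA sB C θ SA SB := by
  simp only [fixedWords, add_comm]

theorem fixedWords_mono (sA : OracleSide W X P) (sB : OracleSide W Y Q) (C : Finset W) (θ : ℝ)
    {SA SA' : Finset P} (SB : Finset Q) (h : SA ⊆ SA') :
    fixedWords sA sB C θ SA SB ⊆ fixedWords sA sB C θ SA' SB := by
  refine Finset.monotone_filter_right _ fun w _ hw => hw.trans ?_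
  gcongr

/-- Bound on the success mass through words that are or will become fixed. -/
noncomputable def gain (sA : OracleSide W X P) (sB : OracleSide W Y Q) (C : Finset W) (θ δ L : ℝ)
    (X' : Finset X) (SA : Finset P) (Y' : Finset Y) (SB : Finset Q) : ℝ :=
  (∑ w ∈ fixedWords sA sB C θ SA SB, sA.hit X' w * sB.hit Y' w) +
    δ * (L - (fixedWords sA sB C θ SA SB).card + 1) * (sA.mass X' * sB.mass Y')

/-- The potential of a rectangle `X' × Y'` whose bits in `SA`, `SB` are fixed to `0`. -/
noncomputable def potential (sA : OracleSide W X P) (sB : OracleSide W Y Q) (C : Finset W) (α θ δ L ℓ : ℝ)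
    (X' : Finset X) (SA : Finset P) (Y' : Finset Y) (SB : Finset Q) : ℝ :=
  (if ((SA.card : ℝ) + SB.card ≤ ℓ) then gain sA sB C θ δ L X' SA Y' SB else 0) +
    (α * ℓ)⁻¹ * (2 * (sB.mass Y' * Real.negMulLog (sA.mass X') +
      sA.mass X' * Real.negMulLog (sB.mass Y')) -
      α * (SA.card + SB.card) * (sA.mass X' * sB.mass Y'))

/-- Lets every step taken by Alice be reused for Bob. -/
theorem potential_comm (sA : OracleSide W X P) (sB : OracleSide W Y Q) (C : Finset W)
    (α θ δ L ℓ : ℝ) (X' : Finset X) (SA : Finset P) (Y' : Finset Y) (SB : Finset Q) :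
    potential sB sA C α θ δ L ℓ Y' SB X' SA = potential sA sB C α θ δ L ℓ X' SA Y' SB := by
  simp only [potential, gain, fixedWords_comm sA sB, add_comm (SB.card : ℝ),
    mul_comm (sB.mass Y') (sA.mass X'), mul_comm (sB.hit Y' _)]
  ring

variable {α θ δ L ℓ : ℝ}

theorem gain_nonneg (hδ : 0 < δ) {SA : Finset P} {SB : Finset Q}
    (hL : ((fixedWords sA sB C θ SA SB).card : ℝ) ≤ L) (X' : Finset X) (Y' : Finset Y) :
    0 ≤ gain sA sB C θ δ L X' SA Y' SB := by
  have h1 : 0 ≤ L - (fixedWords sA sB C θ SA SB).card + 1 := by linarith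
  have h2 := sA.mass_nonneg X'
  have h3 := sB.mass_nonneg Y'
  have h4 : 0 ≤ ∑ w ∈ fixedWords sA sB C θ SA SB, sA.hit X' w * sB.hit Y' w :=
    Finset.sum_nonneg fun w _ => mul_nonneg (sA.hit_nonneg _ _) (sB.hit_nonneg _ _)
  rw [gain]
  positivity

theorem gain_filter_add (X' : Finset X) (SA : Finset P) (Y' : Finset Y) (SB : Finset Q)
    (q : X → Prop) [DecidablePred q] :
    gain sA sB C θ δ L (X'.filter q) SA Y' SB +
      gain sA sB C θ δ L (X'.filter fun x => ¬ q x) SA Y' SB = gain sA sB C θ δ L X' SA Y' SB := by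
  simp only [gain, ← sA.mass_filter_add X' q, ← sA.hit_filter_add X' _ q, add_mul,
    Finset.sum_add_distrib]
  ring

/-- Words that become fixed on one side are unlikely to be consistent on the other side. -/
theorem gain_anti {SA SA' : Finset P} {SB : Finset Q} (h : SA ⊆ SA') {Y' : Finset Y}
    (hB : sB.Refined C θ δ Y' SB) (X' : Finset X) :
    gain sA sB C θ δ L X' SA' Y' SB ≤ gain sA sB C θ δ L X' SA Y' SB := by
  classical
  have hsub := fixedWords_mono sA sB C θ SB h
  have h1 : ∑ w ∈ fixedWords sA sB C θ SA' SB \ fixedWords sA sB C θ SA SB,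
      sA.hit X' w * sB.hit Y' w ≤
      ∑ w ∈ fixedWords sA sB C θ SA' SB \ fixedWords sA sB C θ SA SB,
        δ * (sA.mass X' * sB.mass Y') := by
    refine Finset.sum_le_sum fun w hw => ?_
    simp only [fixedWords, Finset.mem_sdiff, Finset.mem_filter, not_and, not_le] at hw
    -- A word not yet fixed has fewer than `θ` recorded positions in total, hence on the unchanged,
    -- refined side.
    have h2 := hw.2 hw.1.1
    have h3 : ((sB.pos w ∩ SB).card : ℝ) < θ := by
      have : (0 : ℝ) ≤ (sA.pos w ∩ SA).card := Nat.cast_nonneg _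
      linarith
    calc sA.hit X' w * sB.hit Y' w ≤ sA.mass X' * (δ * sB.mass Y') :=
          mul_le_mul (sA.hit_le_mass _ _) (hB w hw.1.1 h3) (sB.hit_nonneg _ _) (sA.mass_nonneg _)
      _ = _ := by ring
  have h2 := Finset.sum_sdiff (f := fun w => sA.hit X' w * sB.hit Y' w) hsub
  have h3 : ((fixedWords sA sB C θ SA' SB \ fixedWords sA sB C θ SA SB).card : ℝ) =
      (fixedWords sA sB C θ SA' SB).card - (fixedWords sA sB C θ SA SB).card := by
    rw [Finset.card_sdiff_of_subset hsub, Nat.cast_sub (Finset.card_le_card hsub)]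
  rw [Finset.sum_const, nsmul_eq_mul, h3] at h1
  rw [gain, gain]
  linarith

/-- Querying whether an input is consistent with a likely word does not increase the potential. -/
theorem potential_query_le (hA : sA.IsHard C α θ δ) (hα : 0 < α) (hℓ : 0 < ℓ) (hδ : 0 < δ)
    (hL : ∀ (SA : Finset P) (SB : Finset Q), (SA.card : ℝ) + SB.card ≤ ℓ →
      ((fixedWords sA sB C θ SA SB).card : ℝ) ≤ L)
    {Y' : Finset Y} {SB : Finset Q} (hB : sB.Refined C θ δ Y' SB) (X' : Finset X)
    (SA : Finset P) {w : W} (hw : w ∈ C) (hθ : ((sA.pos w ∩ SA).card : ℝ) < θ)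
    (hhit : δ * sA.mass X' < sA.hit X' w) :
    potential sA sB C α θ δ L ℓ (X'.filter (sA.Good w)) (SA ∪ sA.pos w) Y' SB +
      potential sA sB C α θ δ L ℓ (X'.filter fun x => ¬ sA.Good w x) SA Y' SB ≤
      potential sA sB C α θ δ L ℓ X' SA Y' SB := by
  have hsplit := sA.mass_filter_add X' (sA.Good w)
  have hcard : ((SA ∪ sA.pos w).card : ℝ) = SA.card + (sA.pos w \ SA).card := by
    rw [← Finset.union_sdiff_self_eq_union, Finset.card_union_of_disjoint Finset.disjoint_sdiff]
    push_cast; rfl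
  have hgain : (if (((SA ∪ sA.pos w).card : ℝ) + SB.card ≤ ℓ) then
        gain sA sB C θ δ L (X'.filter (sA.Good w)) (SA ∪ sA.pos w) Y' SB else 0) +
      (if ((SA.card : ℝ) + SB.card ≤ ℓ) then
        gain sA sB C θ δ L (X'.filter fun x => ¬ sA.Good w x) SA Y' SB else 0) ≤
      if ((SA.card : ℝ) + SB.card ≤ ℓ) then gain sA sB C θ δ L X' SA Y' SB else 0 := by
    by_cases h : (SA.card : ℝ) + SB.card ≤ ℓ
    · rw [if_pos h, if_pos h, ← gain_filter_add X' SA Y' SB (sA.Good w)]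
      gcongr
      -- If recording the word exceeds the budget `ℓ`, its gain is replaced by `0`, which is
      -- harmless because gains are nonnegative.
      split_ifs
      · exact gain_anti Finset.subset_union_left hB _
      · exact gain_nonneg hδ (hL _ _ h) _ _
    · have h' : ¬ ((SA ∪ sA.pos w).card : ℝ) + SB.card ≤ ℓ := by
        rw [hcard]
        have : (0 : ℝ) ≤ (sA.pos w \ SA).card := Nat.cast_nonneg _
        linarith
      simp [h, h']
  have hk := hA.gap w hw SA hθ
  rw [hit] at hhit
  simp only [potential, hcard] at hgain ⊢
  have ha : 0 < sA.mass (X'.filter (sA.Good w)) :=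
    (mul_nonneg hδ.le (sA.mass_nonneg _)).trans_lt hhit
  have hb := sA.mass_nonneg (X'.filter fun x => ¬ sA.Good w x)
  have hv := sB.mass_nonneg Y'
  rw [← hsplit] at hhit ⊢
  have hent := negMulLog_add_le_of_mul_le hδ ha hb hhit.le
  have hlam : 0 < (α * ℓ)⁻¹ := by positivity
  generalize sA.mass (X'.filter (sA.Good w)) = a at *
  generalize sA.mass (X'.filter fun x => ¬ sA.Good w x) = b at *
  generalize sB.mass Y' = v at *
  have h1 := mul_le_mul_of_nonneg_left hent hv
  have h2 := mul_le_mul_of_nonneg_left hk (mul_nonneg ha.le hv)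
  -- The created entropy, at most `2 a v (1 - log δ)`, is covered by the drop `α |pos w \ SA| a v`
  -- from the newly recorded bits.
  have h3 : 2 * (v * Real.negMulLog a + a * Real.negMulLog v) -
        α * (SA.card + (sA.pos w \ SA).card + SB.card) * (a * v) +
      (2 * (v * Real.negMulLog b + b * Real.negMulLog v) - α * (SA.card + SB.card) * (b * v)) ≤
      2 * (v * Real.negMulLog (a + b) + (a + b) * Real.negMulLog v) -
        α * (SA.card + SB.card) * ((a + b) * v) := by
    linarith
  have h4 := mul_le_mul_of_nonneg_left h3 hlam.le
  linarith

/-- A bound by the potential for refined rectangles extends to rectangles that are refined on one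
side only. -/
theorem sum_le_potential_of_refined (hA : sA.IsHard C α θ δ) (hα : 0 < α) (hℓ : 0 < ℓ)
    (hδ : 0 < δ) (hδ1 : δ ≤ 1) [Fintype P]
    (hL : ∀ (SA : Finset P) (SB : Finset Q), (SA.card : ℝ) + SB.card ≤ ℓ →
      ((fixedWords sA sB C θ SA SB).card : ℝ) ≤ L)
    {Y' : Finset Y} {SB : Finset Q} (hB : sB.Refined C θ δ Y' SB) (g : X → ℝ)
    (hg : ∀ X' SA, sA.ZeroOn X' SA → sA.Refined C θ δ X' SA →
      ∑ x ∈ X', g x ≤ potential sA sB C α θ δ L ℓ X' SA Y' SB)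
    (X' : Finset X) (SA : Finset P) (hz : sA.ZeroOn X' SA) :
    ∑ x ∈ X', g x ≤ potential sA sB C α θ δ L ℓ X' SA Y' SB := by
  -- Refinement terminates: the consistent part gets a strictly larger `SA` (by `gap`), the other
  -- part is a strictly smaller `X'`.
  induction hN : X'.card + (SAᶜ).card using Nat.strong_induction_on generalizing X' SA with
  | _ N ih =>
  by_cases href : sA.Refined C θ δ X' SA
  · exact hg X' SA hz href
  simp only [Refined, not_forall, not_le] at href
  obtain ⟨w, hw, hθ, hhit⟩ := href
  refine le_trans ?_ (potential_query_le hA hα hℓ hδ hL hB X' SA hw hθ hhit)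
  rw [← Finset.sum_filter_add_sum_filter_not X' (sA.Good w)]
  refine add_le_add (ih _ ?_ _ _ ?_ rfl) (ih _ ?_ _ _ ?_ rfl)
  · have h2 : (SA ∪ sA.pos w)ᶜ.card < SAᶜ.card := by
      have hgap := hA.gap w hw SA hθ
      have hne : (sA.pos w \ SA).Nonempty := by
        rw [Finset.nonempty_iff_ne_empty]
        intro h0
        have := Real.log_nonpos hδ.le hδ1
        rw [h0, Finset.card_empty, Nat.cast_zero, mul_zero] at hgap
        linarith
      obtain ⟨p, hp⟩ := hne
      rw [Finset.mem_sdiff] at hp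
      refine Finset.card_lt_card (Finset.ssubset_iff_of_subset ?_ |>.2 ⟨p, ?_, ?_⟩)
      · exact Finset.compl_subset_compl.2 Finset.subset_union_left
      · simpa using hp.2
      · simp [hp.1]
    rw [← hN]
    exact add_lt_add_of_le_of_lt (Finset.card_filter_le _ _) h2
  · intro x hx p hp
    rw [Finset.mem_filter] at hx
    rcases Finset.mem_union.1 hp with hp | hp
    · exact hz x hx.1 p hp
    · exact hx.2 p hp
  · have h1 : (X'.filter fun x => ¬ sA.Good w x).card < X'.card := by
      refine Finset.card_lt_card (Finset.ssubset_iff_subset_ne.2 ⟨Finset.filter_subset _ _, ?_⟩)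
      intro h0
      have hpos : 0 < sA.hit X' w := (mul_nonneg hδ.le (sA.mass_nonneg _)).trans_lt hhit
      have := sA.mass_filter_add X' (sA.Good w)
      rw [h0] at this
      rw [hit] at hpos
      linarith
    rw [← hN]
    exact Nat.add_lt_add_right h1 _
  · exact hz.subset (Finset.filter_subset _ _)

-- Bob's answer depends on `y` alone, so each `y` succeeds through one word. That word is either
-- fixed, and counted in `gain`, or unlikely on Alice's side, and covered by the extra `δ`. Only
-- Alice's side must be refined. Past the budget `ℓ`, the entropy part alone exceeds the total mass.
open scoped Classical in
theorem output_le_potential (hA : sA.IsHard C α θ δ) (hB : sB.IsHard C α θ δ) (hα : 0 < α)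
    (hℓ : 0 < ℓ) (hδ : 0 < δ)
    (hL : ∀ (SA : Finset P) (SB : Finset Q), (SA.card : ℝ) + SB.card ≤ ℓ →
      ((fixedWords sA sB C θ SA SB).card : ℝ) ≤ L)
    {X' : Finset X} {SA : Finset P} {Y' : Finset Y} {SB : Finset Q}
    (hAz : sA.ZeroOn X' SA) (hBz : sB.ZeroOn Y' SB) (hAr : sA.Refined C θ δ X' SA)
    (out : Y → W) :
    ∑ x ∈ X', ∑ y ∈ Y', sA.weight x * sB.weight y *
      (if succeeds sA sB C x y (out y) then 1 else 0) ≤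
      potential sA sB C α θ δ L ℓ X' SA Y' SB := by
  -- The factor `2` on the entropy leaves a surplus: twice the entropy is at least `2 α |S| u v`, so
  -- `α |S| u v` survives the subtraction.
  have hu := sA.mass_nonneg X'
  have hv := sB.mass_nonneg Y'
  have huv := mul_nonneg hu hv
  have hent : α * (SA.card + SB.card) * (sA.mass X' * sB.mass Y') ≤
      2 * (sB.mass Y' * Real.negMulLog (sA.mass X') +
        sA.mass X' * Real.negMulLog (sB.mass Y')) -
        α * (SA.card + SB.card) * (sA.mass X' * sB.mass Y') := by
    have h1 := mul_le_mul_of_nonneg_left (hA.le_negMulLog hAz) hv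
    have h2 := mul_le_mul_of_nonneg_left (hB.le_negMulLog hBz) hu
    linarith
  have hlam : 0 < (α * ℓ)⁻¹ := by positivity
  have hent' := mul_le_mul_of_nonneg_left hent hlam.le
  rw [potential]
  split_ifs with hS
  · have h0 : 0 ≤ (α * ℓ)⁻¹ * (α * (SA.card + SB.card) * (sA.mass X' * sB.mass Y')) := by
      positivity
    suffices h : ∑ x ∈ X', ∑ y ∈ Y', sA.weight x * sB.weight y *
        (if succeeds sA sB C x y (out y) then 1 else 0) ≤ gain sA sB C θ δ L X' SA Y' SB by
      linarith
    have hF := hL SA SB hS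
    have key : ∀ y ∈ Y', ∑ x ∈ X', sA.weight x * sB.weight y *
        (if succeeds sA sB C x y (out y) then 1 else 0) ≤
        (∑ w ∈ fixedWords sA sB C θ SA SB,
          sA.hit X' w * (if sB.Good w y then sB.weight y else 0)) +
          δ * sA.mass X' * sB.weight y := by
      intro y _
      have hy := sB.weight_nonneg y
      have hnn : ∀ w, 0 ≤ sA.hit X' w * (if sB.Good w y then sB.weight y else 0) := fun w =>
        mul_nonneg (sA.hit_nonneg _ _) (by split_ifs <;> simp [hy])
      have hle : ∑ x ∈ X', sA.weight x * sB.weight y *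
          (if succeeds sA sB C x y (out y) then 1 else 0) =
          if out y ∈ C then sA.hit X' (out y) * (if sB.Good (out y) y then sB.weight y else 0)
          else 0 := by
        rw [hit, mass, Finset.sum_filter, Finset.sum_mul]
        split_ifs with h1 h2
        · exact Finset.sum_congr rfl fun x _ => by
            by_cases h3 : sA.Good (out y) x <;> simp [succeeds, h1, h2, h3]
        · exact Finset.sum_congr rfl fun x _ => by simp [succeeds, h1, h2]
        · exact Finset.sum_eq_zero fun x _ => by simp [succeeds, h1]
      rw [hle]
      have hsum : 0 ≤ ∑ w ∈ fixedWords sA sB C θ SA SB,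
          sA.hit X' w * (if sB.Good w y then sB.weight y else 0) :=
        Finset.sum_nonneg fun w _ => hnn w
      have hmass : 0 ≤ δ * sA.mass X' * sB.weight y := by positivity
      by_cases hC : out y ∈ C
      · rw [if_pos hC]
        by_cases hfix : out y ∈ fixedWords sA sB C θ SA SB
        · have := Finset.single_le_sum (fun w _ => hnn w) hfix
          linarith
        · simp only [fixedWords, Finset.mem_filter, not_and, not_le] at hfix
          have h2 := hfix hC
          have h3 : ((sA.pos (out y) ∩ SA).card : ℝ) < θ := by
            have : (0 : ℝ) ≤ (sB.pos (out y) ∩ SB).card := Nat.cast_nonneg _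
            linarith
          have h4 : sA.hit X' (out y) * (if sB.Good (out y) y then sB.weight y else 0) ≤
              δ * sA.mass X' * sB.weight y :=
            mul_le_mul (hAr _ hC h3) (by split_ifs <;> simp [hy]) (by split_ifs <;> simp [hy])
              (by positivity)
          linarith
      · rw [if_neg hC]
        linarith
    rw [Finset.sum_comm]
    refine (Finset.sum_le_sum key).trans ?_
    rw [Finset.sum_add_distrib, Finset.sum_comm, ← Finset.mul_sum, gain]
    simp only [← Finset.mul_sum, ← Finset.sum_filter]
    change _ ≤ ∑ w ∈ _, sA.hit X' w * ∑ y ∈ Y'.filter (sB.Good w), sB.weight y + _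
    change _ + δ * sA.mass X' * sB.mass Y' ≤ _
    have : 0 ≤ δ * (L - (fixedWords sA sB C θ SA SB).card) * (sA.mass X' * sB.mass Y') :=
      mul_nonneg (mul_nonneg hδ.le (by linarith)) huv
    linarith
  · rw [zero_add]
    refine le_trans ?_ hent'
    have h1 : ∑ x ∈ X', ∑ y ∈ Y', sA.weight x * sB.weight y *
        (if succeeds sA sB C x y (out y) then 1 else 0) ≤ sA.mass X' * sB.mass Y' := by
      rw [mass, mass, Finset.sum_mul_sum]
      refine Finset.sum_le_sum fun x _ => Finset.sum_le_sum fun y _ => ?_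
      have := mul_nonneg (sA.weight_nonneg x) (sB.weight_nonneg y)
      split_ifs <;> simp [this]
    have h2 : (α * ℓ)⁻¹ * (α * (SA.card + SB.card) * (sA.mass X' * sB.mass Y')) =
        (SA.card + SB.card) / ℓ * (sA.mass X' * sB.mass Y') := by
      field_simp
    rw [h2]
    have h3 : 1 ≤ ((SA.card : ℝ) + SB.card) / ℓ := by
      rw [one_le_div hℓ]; exact (not_le.1 hS).le
    exact h1.trans (le_mul_of_one_le_left huv h3)

/-- Sending a bit increases the potential by at most its entropy. -/
theorem potential_message_le (hα : 0 < α) (hℓ : 0 < ℓ) (X' : Finset X) (SA : Finset P)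
    (Y' : Finset Y) (SB : Finset Q) (q : X → Prop) [DecidablePred q] :
    potential sA sB C α θ δ L ℓ (X'.filter q) SA Y' SB +
      potential sA sB C α θ δ L ℓ (X'.filter fun x => ¬ q x) SA Y' SB ≤
      potential sA sB C α θ δ L ℓ X' SA Y' SB +
        2 * (α * ℓ)⁻¹ * Real.log 2 * (sA.mass X' * sB.mass Y') := by
  have hsplit := sA.mass_filter_add X' q
  have hgain := gain_filter_add (sA := sA) (sB := sB) (C := C) (θ := θ) (δ := δ) (L := L)
    X' SA Y' SB q
  have hlam : 0 < (α * ℓ)⁻¹ := by positivity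
  have hent := mul_le_mul_of_nonneg_left (mul_le_mul_of_nonneg_left (negMulLog_add_le
    (sA.mass_nonneg (X'.filter q)) (sA.mass_nonneg (X'.filter fun x => ¬ q x)))
    (sB.mass_nonneg Y')) hlam.le
  simp only [potential]
  rw [hsplit] at hent
  rw [← hgain]
  have h3 := congrArg (fun u => (α * ℓ)⁻¹ * (2 * (u * Real.negMulLog (sB.mass Y')) -
    α * (SA.card + SB.card) * (u * sB.mass Y'))) hsplit
  split_ifs <;> linarith

/-- Induction on the tree. The penalty per bit equals the rise of the potential per message. A
message spoils refinement only on the sender's side, which is then restored before the induction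
hypothesis applies. -/
theorem value_le_potential [Fintype P] [Fintype Q] (hA : sA.IsHard C α θ δ)
    (hB : sB.IsHard C α θ δ) (hα : 0 < α) (hℓ : 0 < ℓ) (hδ : 0 < δ) (hδ1 : δ ≤ 1)
    (hL : ∀ (SA : Finset P) (SB : Finset Q), (SA.card : ℝ) + SB.card ≤ ℓ →
      ((fixedWords sA sB C θ SA SB).card : ℝ) ≤ L) (t : DetProtocol X Y W)
    (X' : Finset X) (SA : Finset P) (Y' : Finset Y) (SB : Finset Q)
    (hAz : sA.ZeroOn X' SA) (hBz : sB.ZeroOn Y' SB) (hAr : sA.Refined C θ δ X' SA)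
    (hBr : sB.Refined C θ δ Y' SB) :
    value sA sB C (2 * (α * ℓ)⁻¹ * Real.log 2) t X' Y' ≤
      potential sA sB C α θ δ L ℓ X' SA Y' SB := by
  induction t generalizing X' SA Y' SB with
  | output out =>
    refine le_trans (le_of_eq ?_) (output_le_potential hA hB hα hℓ hδ hL hAz hBz hAr out)
    refine Finset.sum_congr rfl fun x _ => Finset.sum_congr rfl fun y _ => ?_
    rw [DetProtocol.bitsSent, Nat.cast_zero, mul_zero, sub_zero, DetProtocol.eval]
  | alice msg next ih =>
    have h : ∀ (b : Bool) (q : X → Prop) [DecidablePred q],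
        value sA sB C (2 * (α * ℓ)⁻¹ * Real.log 2) (next b) (X'.filter q) Y' ≤
          potential sA sB C α θ δ L ℓ (X'.filter q) SA Y' SB := fun b q _ =>
      sum_le_potential_of_refined hA hα hℓ hδ hδ1 hL hBr _
        (fun X₁ S₁ hz hr => ih b X₁ S₁ Y' SB hz hBz hr hBr) _ _
        (hAz.subset (Finset.filter_subset _ _))
    rw [value_alice]
    linarith [h true fun x => msg x = true, h false fun x => ¬ msg x = true,
      potential_message_le (sA := sA) (sB := sB) (C := C) (θ := θ) (δ := δ) (L := L) hα hℓ X' SA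
        Y' SB fun x => msg x = true]
  | bob msg next ih =>
    have hL' : ∀ (SB : Finset Q) (SA : Finset P), (SB.card : ℝ) + SA.card ≤ ℓ →
        ((fixedWords sB sA C θ SB SA).card : ℝ) ≤ L := fun SB SA h => by
      rw [fixedWords_comm]; exact hL SA SB (by rwa [add_comm])
    have h : ∀ (b : Bool) (q : Y → Prop) [DecidablePred q],
        value sA sB C (2 * (α * ℓ)⁻¹ * Real.log 2) (next b) X' (Y'.filter q) ≤
          potential sB sA C α θ δ L ℓ (Y'.filter q) SB X' SA := fun b q _ => by
      rw [value, Finset.sum_comm]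
      refine sum_le_potential_of_refined hB hα hℓ hδ hδ1 hL' hAr _
        (fun Y₁ S₁ hz hr => ?_) _ _ (hBz.subset (Finset.filter_subset _ _))
      rw [Finset.sum_comm, ← value, potential_comm]
      exact ih b X' SA Y₁ S₁ hAz hz hAr hr
    have h' := potential_message_le (sA := sB) (sB := sA) (C := C) (θ := θ) (δ := δ) (L := L) hα hℓ
      Y' SB X' SA fun y => msg y = true
    rw [mul_comm (sB.mass Y'), potential_comm sA sB C α θ δ L ℓ X' SA Y' SB] at h'
    rw [value_bob]
    linarith [h true fun y => msg y = true, h false fun y => ¬ msg y = true]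

/-- The initial rectangle is refined. -/
theorem IsHard.refined_empty [Fintype X] (hA : sA.IsHard C α θ δ) (hδ : 0 < δ) (hδ1 : δ ≤ 1)
    (hmass : sA.mass Finset.univ = 1) : sA.Refined C θ δ Finset.univ ∅ := by
  intro w hw hθ
  rw [hmass, mul_one]
  refine (hA.mass_le _ (sA.pos w) fun x hx => (Finset.mem_filter.1 hx).2).trans ?_
  have h1 := hA.gap w hw ∅ hθ
  rw [Finset.sdiff_empty] at h1
  have h2 := Real.log_nonpos hδ.le hδ1
  calc Real.exp (-(α * (sA.pos w).card)) ≤ Real.exp (Real.log δ) :=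
        Real.exp_le_exp.2 (by linarith)
    _ = δ := Real.exp_log hδ

-- On the full rectangle nothing is recorded and, as `0 < θ`, no word is fixed, so the potential is
-- exactly `δ (L + 1)`.
open scoped Classical in
theorem success_le [Fintype X] [Fintype Y] [Fintype P] [Fintype Q] (hA : sA.IsHard C α θ δ)
    (hB : sB.IsHard C α θ δ) (hα : 0 < α) (hℓ : 0 < ℓ) (hδ : 0 < δ) (hδ1 : δ ≤ 1) (hθ : 0 < θ)
    (hL : ∀ (SA : Finset P) (SB : Finset Q), (SA.card : ℝ) + SB.card ≤ ℓ →
      ((fixedWords sA sB C θ SA SB).card : ℝ) ≤ L)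
    (hmA : sA.mass Finset.univ = 1) (hmB : sB.mass Finset.univ = 1)
    (t : DetProtocol X Y W) {d : ℝ} (hd : ∀ x y, (t.bitsSent x y : ℝ) ≤ d) :
    ∑ x, ∑ y, sA.weight x * sB.weight y *
      (if succeeds sA sB C x y (t.eval x y) then 1 else 0) ≤
      δ * (L + 1) + 2 * (α * ℓ)⁻¹ * Real.log 2 * d := by
  have h := value_le_potential hA hB hα hℓ hδ hδ1 hL t Finset.univ ∅ Finset.univ ∅
    (by simp [ZeroOn]) (by simp [ZeroOn]) (hA.refined_empty hδ hδ1 hmA)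
    (hB.refined_empty hδ hδ1 hmB)
  have hF : fixedWords sA sB C θ ∅ ∅ = ∅ := by simp [fixedWords, hθ]
  simp only [potential, gain, hF, hmA, hmB, Finset.card_empty, Nat.cast_zero, add_zero, hℓ.le,
    if_true, Finset.sum_empty, Real.negMulLog_one, mul_one, mul_zero, sub_zero, zero_add] at h
  set κ := 2 * (α * ℓ)⁻¹ * Real.log 2 with hκ
  have hκ0 : 0 ≤ κ := by have := Real.log_nonneg one_le_two; positivity
  have hdmass : κ * d = ∑ x : X, ∑ y : Y, sA.weight x * sB.weight y * (κ * d) := by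
    have : (∑ x : X, sA.weight x) * ∑ y : Y, sB.weight y = 1 := by
      rw [← mass, ← mass, hmA, hmB, mul_one]
    rw [Finset.sum_mul_sum] at this
    simp only [← Finset.sum_mul, this, one_mul]
  have h2 : ∑ x : X, ∑ y : Y, sA.weight x * sB.weight y *
      (if succeeds sA sB C x y (t.eval x y) then 1 else 0) ≤
      value sA sB C κ t Finset.univ Finset.univ + κ * d := by
    rw [hdmass, value, ← Finset.sum_add_distrib]
    refine Finset.sum_le_sum fun x _ => ?_
    rw [← Finset.sum_add_distrib]
    refine Finset.sum_le_sum fun y _ => ?_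
    rw [← mul_add]
    refine mul_le_mul_of_nonneg_left ?_ (mul_nonneg (sA.weight_nonneg x) (sB.weight_nonneg y))
    linarith [mul_le_mul_of_nonneg_left (hd x y) hκ0]
  linarith

end OracleSide
-- The `p`-biased oracles as a hard side.
/-- The probability that a `p`-biased bit equals `b`. -/
def biasedBit (p : unitInterval) (b : Bool) : ℝ := if b then p else 1 - p

theorem biasedBit_nonneg (p : unitInterval) (b : Bool) : 0 ≤ biasedBit p b := by
  rw [biasedBit]
  split_ifs
  · exact p.2.1
  · linarith [p.2.2]

theorem bernoulliMeasure_real_singleton (p : unitInterval) (b : Bool) :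
    (bernoulliMeasure true false p).real {b} = biasedBit p b := by
  cases b <;> simp [biasedBit, bernoulliMeasure_real_apply p (MeasurableSet.singleton _)]

/-- The weight of an oracle `x` under the `p`-biased distribution. -/
noncomputable def oracleWeight (p : unitInterval) {ι A : Type*} [Fintype ι] [Fintype A]
    (x : ι → A → Bool) : ℝ := ∏ i, ∏ a, biasedBit p (x i a)

theorem oracleWeight_nonneg (p : unitInterval) {ι A : Type*} [Fintype ι] [Fintype A]
    (x : ι → A → Bool) : 0 ≤ oracleWeight p x :=
  Finset.prod_nonneg fun _ _ => Finset.prod_nonneg fun _ _ => biasedBit_nonneg p _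

/-- The total weight of the oracles vanishing on `S`. -/
theorem sum_oracleWeight (p : unitInterval) {ι A : Type*} [Fintype ι] [Fintype A] [DecidableEq ι]
    [DecidableEq A] (S : Finset (ι × A)) :
    ∑ x ∈ Finset.univ.filter (fun x : ι → A → Bool => ∀ q ∈ S, x q.1 q.2 = false),
      oracleWeight p x = (1 - p : ℝ) ^ S.card := by
  -- The event is a product of sets, one per bit, so its weight factors.
  have hset : Finset.univ.filter (fun x : ι → A → Bool => ∀ q ∈ S, x q.1 q.2 = false) =
      Fintype.piFinset fun i => Fintype.piFinset fun a =>
        if (i, a) ∈ S then {false} else Finset.univ := by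
    ext x
    simp only [Finset.mem_filter, Finset.mem_univ, true_and, Fintype.mem_piFinset, Prod.forall]
    refine forall_congr' fun i => forall_congr' fun a => ?_
    split_ifs with h <;> simp [h]
  rw [hset]
  simp only [oracleWeight]
  rw [← Finset.prod_univ_sum (fun i : ι => Fintype.piFinset fun a : A =>
    if (i, a) ∈ S then {false} else (Finset.univ : Finset Bool))
    (fun _ z => ∏ a, biasedBit p (z a))]
  have h1 : ∀ i : ι, ∑ z ∈ (Fintype.piFinset fun a : A =>
      if (i, a) ∈ S then {false} else (Finset.univ : Finset Bool)), ∏ a, biasedBit p (z a) =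
      ∏ a, if (i, a) ∈ S then (1 - p : ℝ) else 1 := by
    intro i
    rw [← Finset.prod_univ_sum (fun a : A =>
      if (i, a) ∈ S then {false} else (Finset.univ : Finset Bool)) (fun _ b => biasedBit p b)]
    refine Finset.prod_congr rfl fun a _ => ?_
    split_ifs <;> simp [biasedBit]
  rw [Finset.prod_congr rfl fun i _ => h1 i,
    ← Fintype.prod_prod_type' (fun i a => if (i, a) ∈ S then (1 - p : ℝ) else 1)]
  simp

/-- The side of a player who holds the oracles at the coordinates `e i`. -/
noncomputable def biasedSide (p : unitInterval) {n : ℕ} {ι A : Type*} [Fintype ι] [Fintype A]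
    [DecidableEq ι] [DecidableEq A] (e : ι → Fin n) :
    OracleSide (Fin n → A) (ι → A → Bool) (ι × A) where
  weight := oracleWeight p
  weight_nonneg := oracleWeight_nonneg p
  bit q x := x q.1 q.2
  pos w := Finset.univ.image fun i => (i, w (e i))

section biasedSide

variable {n : ℕ} {ι A : Type*} [Fintype ι] [Fintype A] [DecidableEq ι] [DecidableEq A]

theorem biasedSide_good (p : unitInterval) (e : ι → Fin n) (w : Fin n → A) (x : ι → A → Bool) :
    (biasedSide p e).Good w x ↔ ∀ i, x i (w (e i)) = false := by
  simp [OracleSide.Good, biasedSide]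

theorem biasedSide_mass_univ (p : unitInterval) (e : ι → Fin n) :
    (biasedSide (A := A) p e).mass Finset.univ = 1 := by
  simpa [OracleSide.mass, biasedSide] using sum_oracleWeight p (∅ : Finset (ι × A))

/-- Forcing `k` bits to vanish has probability `(1 - p) ^ k = exp (-α k)`, and a word has exactly
one position per coordinate held by the player, so more than `|ι| - θ` of them are unrecorded. -/
theorem biasedSide_isHard (p : unitInterval) (hp1 : p < 1) (e : ι → Fin n)
    (C : Finset (Fin n → A)) {θ δ : ℝ} (hα : 0 ≤ -Real.log (1 - p))
    (h : 2 * (1 - Real.log δ) ≤ -Real.log (1 - p) * (Fintype.card ι - θ)) :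
    (biasedSide p e).IsHard C (-Real.log (1 - p)) θ δ where
  mass_le X' S hz := by
    have hp : (0 : ℝ) < 1 - p := sub_pos.2 (by exact_mod_cast hp1)
    calc (biasedSide p e).mass X' ≤ ∑ x ∈ Finset.univ.filter
          (fun x : ι → A → Bool => ∀ q ∈ S, x q.1 q.2 = false), oracleWeight p x :=
          Finset.sum_le_sum_of_subset_of_nonneg
            (fun x hx => Finset.mem_filter.2 ⟨Finset.mem_univ _, hz x hx⟩)
            fun x _ _ => oracleWeight_nonneg p x
      _ = (1 - p : ℝ) ^ S.card := sum_oracleWeight p S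
      _ = Real.exp (-(-Real.log (1 - p) * S.card)) := by
          rw [neg_mul, neg_neg, mul_comm, Real.exp_nat_mul, Real.exp_log hp]
      _ ≤ _ := le_rfl
  gap w _ S hS := by
    refine h.trans (mul_le_mul_of_nonneg_left ?_ hα)
    have h1 : ((biasedSide p e).pos w).card = Fintype.card ι := by
      change (Finset.univ.image fun i => (i, w (e i))).card = _
      rw [Finset.card_image_of_injective _ fun i j hij => (Prod.mk.inj hij).1, Finset.card_univ]
    have h2 := Finset.card_sdiff_add_card_inter ((biasedSide p e).pos w) S
    rw [h1] at h2
    have h3 : ((((biasedSide p e).pos w \ S).card : ℕ) : ℝ) +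
        (((biasedSide p e).pos w ∩ S).card : ℕ) = Fintype.card ι := by exact_mod_cast h2
    linarith

/-- The number of fixed positions of a word is bounded by a number of coordinates. -/
theorem card_pos_inter_le (p : unitInterval) {e : ι → Fin n} (he : Function.Injective e)
    (w : Fin n → A) (S : Finset (ι × A)) (T : Finset (Fin n))
    (hT : ∀ i, (i, w (e i)) ∈ S → e i ∈ T) : ((biasedSide p e).pos w ∩ S).card ≤ T.card := by
  have hmem : ∀ q, q ∈ (biasedSide p e).pos w ↔ (q.1, w (e q.1)) = q := fun q => by
    change q ∈ Finset.univ.image (fun i => (i, w (e i))) ↔ _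
    simp only [Finset.mem_image, Finset.mem_univ, true_and]
    exact ⟨fun ⟨i, hi⟩ => by subst hi; rfl, fun h => ⟨_, h⟩⟩
  refine Finset.card_le_card_of_injOn (fun q => e q.1) (fun q hq => ?_) fun q hq r hr hqr => ?_
  · rw [Finset.mem_coe, Finset.mem_inter, hmem] at hq
    exact hT _ (by rw [hq.1]; exact hq.2)
  · rw [Finset.mem_coe, Finset.mem_inter, hmem] at hq hr
    rw [← hq.1, ← hr.1, he hqr]

end biasedSide

/-! ### The two halves of the input and list-recoverability. -/

section bipartite

variable {n : ℕ} {A : Type*} [Fintype A]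

theorem biasedOracle_real_singleton (p : unitInterval) (H : Fin n → A → Bool) :
    (biasedOracle n A p).real {H} = oracleWeight p H := by
  simp only [Measure.real, biasedOracle, Measure.pi_singleton, ENNReal.toReal_prod, oracleWeight]
  exact Finset.prod_congr rfl fun i _ => Finset.prod_congr rfl fun a _ =>
    bernoulliMeasure_real_singleton p _

instance (p : unitInterval) : IsProbabilityMeasure (biasedOracle n A p) := by
  rw [biasedOracle]; infer_instance

instance (p : unitInterval) : IsProbabilityMeasure (biasedInput n A p) :=
  Measure.isProbabilityMeasure_map (Measurable.of_discrete).aemeasurable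

theorem biasedInput_real_singleton (p : unitInterval) (x : AliceInput n A) (y : BobInput n A) :
    (biasedInput n A p).real {(x, y)} = oracleWeight p x * oracleWeight p y := by
  set H : Fin n → A → Bool := fun i =>
    if h : (i : ℕ) < n / 2 then x ⟨i, h⟩ else y ⟨i, not_lt.1 h⟩ with hH
  have hx : ∀ i : {i : Fin n // (i : ℕ) < n / 2}, H i = x i := fun i => by simp [hH, i.2]
  have hy : ∀ i : {i : Fin n // n / 2 ≤ (i : ℕ)}, H i = y i := fun i => by
    simp [hH, not_lt.2 i.2]
  have hpre : splitOracle ⁻¹' {(x, y)} = {H} := by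
    ext G
    simp only [Set.mem_preimage, Set.mem_singleton_iff, splitOracle, Prod.mk.injEq]
    constructor
    · rintro ⟨h1, h2⟩
      funext i
      by_cases h : (i : ℕ) < n / 2
      · rw [hx ⟨i, h⟩, ← h1]
      · rw [hy ⟨i, not_lt.1 h⟩, ← h2]
    · rintro rfl
      exact ⟨funext hx, funext hy⟩
  rw [biasedInput, map_measureReal_apply Measurable.of_discrete (MeasurableSet.singleton _), hpre,
    biasedOracle_real_singleton, oracleWeight,
    ← Fintype.prod_subtype_mul_prod_subtype (fun i : Fin n => (i : ℕ) < n / 2)]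
  congr 1
  · exact Finset.prod_congr rfl fun i _ => by rw [hx i]
  · exact Fintype.prod_equiv (Equiv.subtypeEquivRight fun i => not_lt) _ _ fun i => by
      rw [← hy]; rfl

open scoped Classical in
theorem biasedInput_real_apply (p : unitInterval) (G : Set (AliceInput n A × BobInput n A)) :
    (biasedInput n A p).real G =
      ∑ x, ∑ y, oracleWeight p x * oracleWeight p y * (if (x, y) ∈ G then 1 else 0) := by
  have h : (biasedInput n A p).real G = ∑ z ∈ G.toFinset, (biasedInput n A p).real {z} := by
    rw [sum_measureReal_singleton, Set.coe_toFinset]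
  rw [h, ← Fintype.sum_prod_type' (fun x y => oracleWeight p x * oracleWeight p y *
    (if (x, y) ∈ G then (1 : ℝ) else 0)), ← Finset.filter_univ_mem G.toFinset, Finset.sum_filter]
  refine Finset.sum_congr rfl fun z _ => ?_
  rw [biasedInput_real_singleton]
  simp

/-- List-recoverability bounds the number of words with `0.4 n` fixed positions. -/
theorem ListRecoverable.card_fixedWords_le [DecidableEq A] {C : Set (Fin n → A)} {ζ ℓ L : ℝ}
    (hC : ListRecoverable C ζ ℓ L) (hζ : ζ ≤ 0.4) (p : unitInterval)
    (SA : Finset ({i : Fin n // (i : ℕ) < n / 2} × A))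
    (SB : Finset ({i : Fin n // n / 2 ≤ (i : ℕ)} × A)) (hS : (SA.card : ℝ) + SB.card ≤ ℓ) :
    ((OracleSide.fixedWords (biasedSide p Subtype.val) (biasedSide p Subtype.val)
      (Set.toFinite C).toFinset (0.4 * n) SA SB).card : ℝ) ≤ L := by
  classical
  -- The recorded symbols at each coordinate form the lists; the budget `ℓ` on all recorded bits
  -- trivially bounds each list.
  set S : Fin n → Set A := fun i => {a | (∃ h, (⟨i, h⟩, a) ∈ SA) ∨ ∃ h, (⟨i, h⟩, a) ∈ SB} with hSdef
  have hcard : ∀ i, ((S i).ncard : ℝ) ≤ ℓ := by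
    intro i
    have hsub : S i ⊆ (SA.image Prod.snd ∪ SB.image Prod.snd : Finset A) := by
      rintro a (⟨h, ha⟩ | ⟨h, ha⟩)
      · exact Finset.mem_coe.2 (Finset.mem_union_left _ (Finset.mem_image_of_mem Prod.snd ha))
      · exact Finset.mem_coe.2 (Finset.mem_union_right _ (Finset.mem_image_of_mem Prod.snd ha))
    have h1 := Set.ncard_le_ncard hsub (Finset.finite_toSet _)
    rw [Set.ncard_coe_finset] at h1
    have h2 : (S i).ncard ≤ SA.card + SB.card :=
      h1.trans ((Finset.card_union_le _ _).trans
        (add_le_add Finset.card_image_le Finset.card_image_le))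
    exact le_trans (by exact_mod_cast h2) hS
  refine le_trans ?_ (hC S hcard)
  rw [← Set.ncard_coe_finset]
  refine Nat.cast_le.2 (Set.ncard_le_ncard (fun w hw => ?_) (Set.toFinite _))
  simp only [OracleSide.fixedWords, Finset.coe_filter, Set.Finite.mem_toFinset,
    Set.mem_ofPred_eq] at hw
  refine ⟨hw.1, ?_⟩
  refine (mul_le_mul_of_nonneg_right hζ (Nat.cast_nonneg n)).trans (hw.2.trans ?_)
  have hA := card_pos_inter_le p Subtype.val_injective w SA
    ((Finset.univ.filter fun i => w i ∈ S i).filter fun i : Fin n => (i : ℕ) < n / 2)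
    fun i hi => by simp only [Finset.mem_filter, Finset.mem_univ, true_and]
                   exact ⟨Or.inl ⟨i.2, hi⟩, i.2⟩
  have hB := card_pos_inter_le p Subtype.val_injective w SB
    ((Finset.univ.filter fun i => w i ∈ S i).filter fun i : Fin n => ¬ (i : ℕ) < n / 2)
    fun i hi => by simp only [Finset.mem_filter, Finset.mem_univ, true_and]
                   exact ⟨Or.inr ⟨i.2, hi⟩, not_lt.2 i.2⟩
  have hAB := Finset.card_filter_add_card_filter_not (s := Finset.univ.filter fun i => w i ∈ S i)
    (fun i : Fin n => (i : ℕ) < n / 2)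
  have hset : ({i | w i ∈ S i} : Set (Fin n)).ncard =
      (Finset.univ.filter fun i => w i ∈ S i).card := by
    rw [← Set.ncard_coe_finset]; simp
  rw [hset]
  exact_mod_cast (by omega : _ ≤ _)

/-- Success probability of a deterministic protocol for `BiNC`. -/
theorem biNC_success_le {C : Set (Fin n → A)} {ζ ℓ L α δ d : ℝ} (p : unitInterval) (hp1 : p < 1)
    (hα : α = -Real.log (1 - p)) (hα0 : 0 < α) (hn : 10 ≤ n) (hδ : 0 < δ) (hδ1 : δ ≤ 1)
    (hδn : 1 - Real.log δ ≤ α * n / 40) (hC : ListRecoverable C ζ ℓ L) (hζ : ζ ≤ 0.4)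
    (hℓ : 0 < ℓ) (t : DetProtocol (AliceInput n A) (BobInput n A) (Fin n → A))
    (hd : ∀ x y, (t.bitsSent x y : ℝ) ≤ d) :
    (biasedInput n A p).real {z | (z.1, z.2, t.eval z.1 z.2) ∈ BiNC C} ≤
      δ * (L + 1) + 2 * (α * ℓ)⁻¹ * Real.log 2 * d := by
  classical
  have hn' : (10 : ℝ) ≤ n := by exact_mod_cast hn
  have hhalf : (n : ℝ) / 2 - 1 / 2 ≤ ((n / 2 : ℕ) : ℝ) := by
    have : n ≤ 2 * (n / 2) + 1 := by omega
    have : (n : ℝ) ≤ 2 * ((n / 2 : ℕ) : ℝ) + 1 := by exact_mod_cast this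
    linarith
  have hcA : Fintype.card {i : Fin n // (i : ℕ) < n / 2} = n / 2 := by
    rw [Fintype.card_subtype, Fin.card_filter_val_lt]; omega
  have hcB : Fintype.card {i : Fin n // n / 2 ≤ (i : ℕ)} = n - n / 2 := by
    have h := Fintype.card_subtype_compl fun i : Fin n => (i : ℕ) < n / 2
    simp only [not_lt, hcA, Fintype.card_fin] at h
    exact h
  -- Either half has at least `n/2 - 1/2` coordinates, and `n/2 - 1/2 - 0.4 n ≥ n/20` for `n ≥ 10`;
  -- this is why `0.4`, below one half, works.
  have hgap : ∀ k : ℕ, n / 2 ≤ k →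
      2 * (1 - Real.log δ) ≤ -Real.log (1 - p) * (k - 0.4 * n) := by
    intro k hk
    have hk' : ((n / 2 : ℕ) : ℝ) ≤ k := by exact_mod_cast hk
    rw [← hα]
    have : α * (n / 20) ≤ α * (k - 0.4 * n) := mul_le_mul_of_nonneg_left (by linarith) hα0.le
    linarith
  have hA := biasedSide_isHard p hp1 (Subtype.val : {i : Fin n // (i : ℕ) < n / 2} → Fin n)
    (Set.toFinite C).toFinset (hα ▸ hα0.le) (hgap _ hcA.ge)
  have hB := biasedSide_isHard p hp1 (Subtype.val : {i : Fin n // n / 2 ≤ (i : ℕ)} → Fin n)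
    (Set.toFinite C).toFinset (hα ▸ hα0.le) (hgap _ (by rw [hcB]; omega))
  rw [← hα] at hA hB
  refine le_trans (le_of_eq ?_) (OracleSide.success_le hA hB hα0 hℓ hδ hδ1 (by positivity)
    (hC.card_fixedWords_le hζ p) (biasedSide_mass_univ p _) (biasedSide_mass_univ p _) t hd)
  rw [biasedInput_real_apply]
  refine Finset.sum_congr rfl fun x _ => Finset.sum_congr rfl fun y _ => ?_
  congr 1
  refine if_congr ?_ rfl rfl
  simp only [Set.mem_ofPred_eq, BiNC, OracleSide.succeeds, biasedSide_good,
    Set.Finite.mem_toFinset]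

end bipartite

/-! ### Randomized protocols, asymptotics and the constants. -/

/-- Yao's principle: a distributional lower bound from a bound on deterministic protocols. -/
theorem natCast_le_randCC {X Y O : Type*} [MeasurableSpace X] [MeasurableSpace Y]
    {R : Set (X × Y × O)} {μ : Measure (X × Y)} {ε ε' : ℝ} (hε' : 0 < ε') (hε : ε < ε') {k : ℕ}
    (h : ∀ t : DetProtocol X Y O, (∀ x y, t.bitsSent x y < k) →
      ENNReal.ofReal ε' ≤ μ {z | (z.1, z.2, t.eval z.1 z.2) ∉ R}) :
    (k : ℕ∞) ≤ randCC R μ ε := by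
  refine le_iInf fun P => le_iInf fun hP => ?_
  by_contra! hk
  have hle : ∀ t, P t * ENNReal.ofReal ε' ≤ P t * μ {z | (z.1, z.2, t.eval z.1 z.2) ∉ R} := by
    intro t
    by_cases ht : t ∈ P.support
    · refine mul_le_mul_right (h t fun x y => ?_) _
      have h1 : (t.bitsSent x y : ℕ∞) ≤ P.cost :=
        le_iSup₂_of_le t ht (le_iSup₂_of_le x y le_rfl)
      exact_mod_cast h1.trans_lt hk
    · rw [PMF.mem_support_iff, not_not] at ht
      simp [ht]
  have h2 := ENNReal.tsum_le_tsum hle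
  rw [ENNReal.tsum_mul_right, P.tsum_coe, one_mul] at h2
  have h3 := h2.trans hP
  -- Truncation at `0` leaves the alternative `ε' ≤ 0`, excluded by `hε'`.
  rw [ENNReal.ofReal_le_ofReal_iff'] at h3
  rcases h3 with h3 | h3 <;> linarith

theorem tendsto_exp_mul_add_one {γ : ℝ} (hγ : 0 < γ) {L g : ℕ → ℝ}
    (hg : g =o[atTop] fun n => (n : ℝ)) (hL : ∀ᶠ n in atTop, L n ≤ (2 : ℝ) ^ g n) {η : ℝ}
    (hη : 0 < η) : ∀ᶠ n : ℕ in atTop, Real.exp (-(γ * n)) * (L n + 1) ≤ η := by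
  have hlim : Tendsto (fun n : ℕ => 2 * Real.exp (-(γ / 2 * n))) atTop (nhds 0) := by
    have h1 : Tendsto (fun n : ℕ => γ / 2 * (n : ℝ)) atTop atTop :=
      tendsto_natCast_atTop_atTop.const_mul_atTop (by positivity)
    simpa using (Real.tendsto_exp_neg_atTop_nhds_zero.comp h1).const_mul 2
  filter_upwards [hL, hg.bound (show 0 < γ / 2 by positivity), hlim.eventually_le_const hη]
    with n hLn hgn hn
  refine le_trans ?_ hn
  have hg' : g n ≤ γ / 2 * n := by simpa using (le_abs_self _).trans hgn
  have hn0 : 0 ≤ γ / 2 * n := by positivity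
  have h2 : (2 : ℝ) ^ g n ≤ Real.exp (γ / 2 * n) := by
    calc (2 : ℝ) ^ g n ≤ 2 ^ (γ / 2 * n) := Real.rpow_le_rpow_of_exponent_le one_le_two hg'
      _ ≤ Real.exp 1 ^ (γ / 2 * n) :=
        Real.rpow_le_rpow zero_le_two (by linarith [Real.add_one_le_exp 1]) hn0
      _ = _ := by rw [← Real.exp_mul, one_mul]
  have h3 : L n + 1 ≤ 2 * Real.exp (γ / 2 * n) := by linarith [Real.one_le_exp hn0]
  calc Real.exp (-(γ * n)) * (L n + 1) ≤
        Real.exp (-(γ * n)) * (2 * Real.exp (γ / 2 * n)) := by gcongr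
    _ = 2 * (Real.exp (-(γ * n)) * Real.exp (γ / 2 * n)) := by ring
    _ = 2 * Real.exp (-(γ / 2 * n)) := by rw [← Real.exp_add]; congr 2; ring

theorem mainTheorem2 (p : unitInterval) (hp0 : 0 < p) (hp1 : p < 1)
    (ε : ℝ) (hε0 : 0 ≤ ε) (hε1 : ε < 1) :
    ∃ c : ℝ, 0 < c ∧
      ∀ (A : ℕ → Type*) [∀ n, Fintype (A n)] (C : ∀ n, Set (Fin n → A n)) (ζ ℓ L : ℕ → ℝ),
        (∀ n, ListRecoverable (C n) (ζ n) (ℓ n) (L n)) →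
        (∀ n, ζ n ≤ 0.4) →
        (∃ g : ℕ → ℝ, g =o[atTop] (fun n => (n : ℝ)) ∧ ∀ᶠ n in atTop, L n ≤ (2 : ℝ) ^ g n) →
        ∀ᶠ n in atTop,
          ENNReal.ofReal (c * ℓ n) ≤
            ((randCC (BiNC (C n)) (biasedInput n (A n) p) ε : ℕ∞) : ℝ≥0∞) := by
  obtain ⟨α, hα⟩ : ∃ α, α = -Real.log (1 - p) := ⟨_, rfl⟩
  have hp0' : (0 : ℝ) < p := by exact_mod_cast hp0
  have hp1' : (p : ℝ) < 1 := by exact_mod_cast hp1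
  have hα0 : 0 < α := by
    rw [hα, neg_pos]
    exact Real.log_neg (by linarith) (by linarith)
  have hlog2 : 0 < Real.log 2 := Real.log_pos one_lt_two
  -- Chosen so that `c ℓ` bits contribute `(1 - ε) / 4` to the success; `δ (L + 1)` contributes at
  -- most as much, so the error is at least `(1 + ε) / 2 > ε`.
  refine ⟨(1 - ε) * α / (8 * Real.log 2), by have := sub_pos.2 hε1; positivity, ?_⟩
  rintro A _ C ζ ℓ L hC hζ ⟨g, hg, hL⟩
  filter_upwards [tendsto_exp_mul_add_one (γ := α / 80) (by positivity) hg hL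
      (show 0 < (1 - ε) / 4 by linarith), eventually_ge_atTop 10,
    tendsto_natCast_atTop_atTop.eventually_ge_atTop (80 / α)] with n hLn hn hnα
  rcases le_or_gt (ℓ n) 0 with hℓ | hℓ
  · rw [ENNReal.ofReal_of_nonpos (mul_nonpos_of_nonneg_of_nonpos
      (by have := sub_pos.2 hε1; positivity) hℓ)]
    exact zero_le
  set c := (1 - ε) * α / (8 * Real.log 2) with hc
  have hk : ((⌈c * ℓ n⌉₊ : ℕ) : ℕ∞) ≤ randCC (BiNC (C n)) (biasedInput n (A n) p) ε := by
    refine natCast_le_randCC (ε' := (1 + ε) / 2) (by linarith) (by linarith) fun t ht => ?_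
    -- For this `δ`, `1 - log δ = 1 + α n / 80`, which is at most `α n / 40` once `n ≥ 80 / α`.
    have hsucc := biNC_success_le (δ := Real.exp (-(α / 80 * n))) (d := c * ℓ n) p hp1 hα hα0 hn
      (Real.exp_pos _) (Real.exp_le_one_iff.2 (neg_nonpos.2 (by positivity)))
      (by rw [div_le_iff₀ hα0] at hnα; rw [Real.log_exp]; linarith) (hC n) (hζ n) hℓ t
      fun x y => (Nat.lt_ceil.1 (ht x y)).le
    have hbits : 2 * (α * ℓ n)⁻¹ * Real.log 2 * (c * ℓ n) = (1 - ε) / 4 := by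
      rw [hc]; field_simp; ring
    have hcompl : (biasedInput n (A n) p).real {z | (z.1, z.2, t.eval z.1 z.2) ∉ BiNC (C n)} =
        1 - (biasedInput n (A n) p).real {z | (z.1, z.2, t.eval z.1 z.2) ∈ BiNC (C n)} :=
      probReal_compl_eq_one_sub (MeasurableSet.of_discrete)
    rw [ENNReal.ofReal_le_iff_le_toReal (measure_ne_top _ _)]
    change _ ≤ (biasedInput n (A n) p).real _
    rw [hcompl]
    linarith
  calc ENNReal.ofReal (c * ℓ n) ≤ ENNReal.ofReal (⌈c * ℓ n⌉₊ : ℕ) :=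
        ENNReal.ofReal_le_ofReal (Nat.le_ceil _)
    _ = (((⌈c * ℓ n⌉₊ : ℕ) : ℕ∞) : ℝ≥0∞) := by simp
    _ ≤ _ := ENat.toENNReal_le.2 hk
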